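/- A computable Polish metric space is a complete metric space $(X,d)$ together with a dense sequence $(q_i)_{i\in\omega}$ of points of $X$ whose distances $d(q_i,q_j)$ are computable real numbers uniformly in $i,j$. A sequence $(y_n)_{n\in\omega}$ in $X$ is computable if there is a computable $f:\omega\times\omega\to\omega$ with $d(y_n,q_{f(n,k)})\le 2^{-k}$ for all $n,k$. For tuples $a,b\in X^k$, write $a\equiv_1 b$ (level-$1$ Scott equivalence) if for every $y\in X$ there is $z\in X$ such that the enumerated metric spaces $(a,y)$ and $(b,z)$ are isometric (corresponding entries have equal mutual distances), and for every $z\in X$ there is $y\in X$ with the same property. For single points $p,q$ this says $\{d(p,y): y\in X\}=\{d(q,z): z\in X\}$. **Proposition.** There are a computable Polish metric space $(X,d)$ and a computable sequence $\langle y_n^*\mid n\in\omega\rangle$ of pairwise distinct elements of $X$ such that the set $$C_1=\{(m,n)\in\omega\times\omega \mid y_m^*\equiv_1 y_n^*\}$$ is (lightface) $\Pi^1_2$-complete: $C_1$ is $\Pi^1_2$, and for every $\Pi^1_2$ set $B\subseteq\omega$ there is a computable injection $h:\omega\to\omega\times\omega$ such that $n\in B\Leftrightarrow h(n)\in C_1$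 for all $n$. -/

import Mathlib

namespace ScottPolish

/-! Lightface pointclasses on the product spaces `α × (ℕ → ℕ)ᵏ`, where `α` is a
coded countable type such as `ℕ` or `ℕ × ℕ`. -/

section Pointclasses

variable {α : Type} [Primcodable α] {k : ℕ}

/-- The finite sequence `s` is an initial segment of `f`. -/
def IsInitialSegment (s : List ℕ) (f : ℕ → ℕ) : Prop :=
  (List.range s.length).map f = s

/-- `Σ⁰₁` sets (semirecursive, effectively open): unions of recursively enumerable families of
basic open sets `{a} × [s₁] × ⋯ × [sₖ]`. -/
def IsSigma01 (A : Set (α × (Fin k → ℕ → ℕ))) : Prop :=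
  ∃ W : α × (Fin k → List ℕ) → Prop, REPred W ∧
    ∀ (a : α) (x : Fin k → ℕ → ℕ),
      (a, x) ∈ A ↔ ∃ s : Fin k → List ℕ, W (a, s) ∧ ∀ i, IsInitialSegment (s i) (x i)

/-- `Π⁰₁` sets (effectively closed). -/
def IsPi01 (A : Set (α × (Fin k → ℕ → ℕ))) : Prop := IsSigma01 Aᶜ

/-- The projection of `Q` along its first Baire space coordinate. -/
def projBaire (Q : Set (α × (Fin (k + 1) → ℕ → ℕ))) : Set (α × (Fin k → ℕ → ℕ)) :=
  {p | ∃ f : ℕ → ℕ, (p.1, (Fin.cons f p.2 : Fin (k + 1) → ℕ → ℕ)) ∈ Q}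

/-- `Σ¹₁` sets: projections of `Π⁰₁` sets. -/
def IsSigma11 (A : Set (α × (Fin k → ℕ → ℕ))) : Prop :=
  ∃ Q : Set (α × (Fin (k + 1) → ℕ → ℕ)), IsPi01 Q ∧ A = projBaire Q

/-- `Π¹₁` sets: complements of `Σ¹₁` sets. -/
def IsPi11 (A : Set (α × (Fin k → ℕ → ℕ))) : Prop := IsSigma11 Aᶜ

/-- `Σ¹₂` sets: projections of `Π¹₁` sets. -/
def IsSigma12 (A : Set (α × (Fin k → ℕ → ℕ))) : Prop :=
  ∃ Q : Set (α × (Fin (k + 1) → ℕ → ℕ)), IsPi11 Q ∧ A = projBaire Q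

/-- `Π¹₂` sets: complements of `Σ¹₂` sets. -/
def IsPi12 (A : Set (α × (Fin k → ℕ → ℕ))) : Prop := IsSigma12 Aᶜ

/-- A set `C ⊆ α` is `Π¹₂`: the case of no Baire space coordinates. -/
def IsPi12Set (C : Set α) : Prop :=
  IsPi12 (k := 0) {p : α × (Fin 0 → ℕ → ℕ) | p.1 ∈ C}

/-- `C` is `Π¹₂`-complete: it is `Π¹₂`, and every `Π¹₂` set of natural numbers is reducible to `C`
by a computable injection (in particular many-one reducible to `C`). -/
def IsPi12Complete (C : Set α) : Prop :=
  IsPi12Set C ∧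
    ∀ B : Set ℕ, IsPi12Set B → OneOneReducible (fun n : ℕ => n ∈ B) (fun a : α => a ∈ C)

end Pointclasses

/-! Computable metric spaces. -/

/-- A computable structure on a metric space: a dense sequence of special points whose mutual
distances are computable reals, uniformly in the indices. A complete metric space with such a
structure is a computable Polish metric space. -/
structure ComputableStructure (X : Type) [MetricSpace X] where
  pt : ℕ → X
  dense_pt : DenseRange pt
  dist_computable : ∃ a : ℕ × ℕ × ℕ → ℕ, Computable a ∧
    ∀ i j k : ℕ, |dist (pt i) (pt j) - (a (i, j, k) : ℝ) / 2 ^ k| ≤ 1 / 2 ^ k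

/-- `y` is a computable sequence of points: from `n` and `k` one can compute the index of a
special point at distance at most `2⁻ᵏ` from `y n`. -/
def ComputableStructure.IsComputableSeq {X : Type} [MetricSpace X]
    (S : ComputableStructure X) (y : ℕ → X) : Prop :=
  ∃ f : ℕ × ℕ → ℕ, Computable f ∧ ∀ n k : ℕ, dist (y n) (S.pt (f (n, k))) ≤ 1 / 2 ^ k

/-! The Scott relation at level one. -/

/-- The enumerated metric spaces `a` and `b` are isometric via `a i ↦ b i`. -/
def IsometricTuples {X : Type} [MetricSpace X] {k : ℕ} (a b : Fin k → X) : Prop :=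
  ∀ i j, dist (a i) (a j) = dist (b i) (b j)

/-- The tuple `a` extended by the point `y`. -/
def extend {X : Type} {k : ℕ} (a : Fin k → X) (y : X) : Fin (k + 1) → X :=
  Fin.snoc (α := fun _ => X) a y

/-- Level-one Scott equivalence of tuples: each challenge on one side has a response on the other
side such that the extended enumerated metric spaces are isometric. -/
def ScottEquivOne {X : Type} [MetricSpace X] {k : ℕ} (a b : Fin k → X) : Prop :=
  (∀ y : X, ∃ z : X, IsometricTuples (extend a y) (extend b z)) ∧
    (∀ z : X, ∃ y : X, IsometricTuples (extend a y) (extend b z))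

end ScottPolish

/-! ### Cones over a metric space and the distances from their apexes -/

namespace ScottPolish

open Filter Topology

/-! The space is a disjoint union of cones over Baire space, with distance 2 between different
cones; the sequence consists of the apexes. The distances from the `n`-th apex are 0, 2 and the
heights `height n x` in `[1, 2)`, so two apexes are equivalent iff their heights have the same range
(`ConeSum.scottEquivOne_apex_iff`). A height encodes a bit sequence injectively, so the question
becomes equality of two analytic sets of bit sequences, `SameBits`.

A point `x` codes a function `f`, a flag and a witness `g`. Its bits list the graph of `f` until `x`
is expelled, and are false from then on. With flag 0, expulsion happens when a semirecursive test
finds that `g` fails for `f`; with a nonzero flag, at a prescribed stage. Bits already emitted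
cannot be revoked, so failed witnesses leave truncated graphs; the flag puts all truncated graphs
into the set of every index. The sets can then differ only in full graphs: the index `e` agrees with
an index that expels nothing iff every `f` has a surviving witness (`sameBits_iff`). This is the
general form `∀ f ∃ g` of a `Π¹₂` condition, which gives hardness. The upper bound holds because
equality of the two ranges is itself of the form `∀ x ∃ w` with an effectively closed matrix. -/

theorem scottEquivOne_singleton_iff {X : Type} [MetricSpace X] (p q : X) :
    ScottEquivOne (fun _ : Fin 1 => p) (fun _ : Fin 1 => q) ↔
      (∀ y, ∃ z, dist p y = dist q z) ∧ ∀ z, ∃ y, dist p y = dist q z := by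
  have key : ∀ y z : X, IsometricTuples (extend (fun _ : Fin 1 => p) y)
      (extend (fun _ : Fin 1 => q) z) ↔ dist p y = dist q z := by
    intro y z
    simp only [IsometricTuples, extend]
    rw [Fin.forall_fin_two, Fin.forall_fin_two, Fin.forall_fin_two]
    have h0 : ∀ a b : X, (Fin.snoc (α := fun _ => X) (fun _ : Fin 1 => a) b : Fin 2 → X) 0 = a :=
      fun a b => rfl
    have h1 : ∀ a b : X, (Fin.snoc (α := fun _ => X) (fun _ : Fin 1 => a) b : Fin 2 → X) 1 = b :=
      fun a b => rfl
    simp only [h0, h1, dist_self, true_and, and_true, dist_comm y p, dist_comm z q, and_self]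
  simp only [ScottEquivOne, key]

/-- The points of a disjoint union of cones over `E`, indexed by `ℕ`; `h n x` is going to be the
distance from the `n`-th apex to the point `x` of the `n`-th base. -/
inductive ConeSum {E : Type} (h : ℕ → E → ℝ) : Type
  | apex (n : ℕ) : ConeSum h
  | base (n : ℕ) (x : E) : ConeSum h

/-- The conditions on `h` under which the disjoint union of cones is a metric space in which points
of different cones have distance `2`. -/
structure IsHeight {E : Type} [MetricSpace E] (h : ℕ → E → ℝ) : Prop where
  dist_le_one : ∀ x y : E, dist x y ≤ 1
  one_le : ∀ n x, 1 ≤ h n x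
  lt_two : ∀ n x, h n x < 2
  lipschitz : ∀ n x y, h n x ≤ h n y + dist x y

namespace ConeSum

variable {E : Type} [MetricSpace E] {h : ℕ → E → ℝ}

/-- The distance of the disjoint union of cones. -/
noncomputable def coneDist : ConeSum h → ConeSum h → ℝ
  | apex m, apex n => if m = n then 0 else 2
  | apex m, base n x => if m = n then h n x else 2
  | base m x, apex n => if m = n then h n x else 2
  | base m x, base n y => if m = n then dist x y else 2

/-- The metric of the disjoint union of cones. -/
@[reducible] noncomputable def metricSpace (H : IsHeight h) : MetricSpace (ConeSum h) where
  dist := coneDist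
  dist_self p := by cases p <;> simp [coneDist]
  dist_comm p q := by
    cases p <;> cases q <;> simp only [coneDist, eq_comm, dist_comm] <;> split_ifs <;> simp_all
  -- Distances never exceed 2, so a detour through another cone, of length 4, is harmless. A path
  -- between base points through their apex has length at least 2, and a path from the apex through
  -- another base point is controlled by the Lipschitz condition.
  dist_triangle p q r := by
    cases p with
    | apex l =>
      cases q with
      | apex m =>
        cases r with
        | apex n => simp only [coneDist]; split_ifs <;> first | omega | norm_num
        | base n z =>
          have := H.one_le n z
          have := H.lt_two n z
          simp only [coneDist]; split_ifs <;> first | omega | linarith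
      | base m y =>
        have := H.one_le m y
        have := H.lt_two m y
        cases r with
        | apex n => simp only [coneDist]; split_ifs <;> first | omega | (subst_vars; linarith)
        | base n z =>
          have := H.one_le n z
          have := H.lt_two n z
          have := H.lipschitz n z y
          rw [dist_comm] at this
          simp only [coneDist]; split_ifs <;> first
            | omega | (subst_vars; linarith [dist_nonneg (x := y) (y := z)])
    | base l x =>
      have := H.one_le l x
      have := H.lt_two l x
      cases q with
      | apex m =>
        cases r with
        | apex n => simp only [coneDist]; split_ifs <;> first | omega | (subst_vars; linarith)
        | base n z =>
          have := H.one_le n z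
          have := H.lt_two n z
          have := H.dist_le_one x z
          simp only [coneDist]; split_ifs <;> first | omega | (subst_vars; linarith)
      | base m y =>
        have := H.one_le m y
        have := H.lt_two m y
        have := dist_nonneg (x := x) (y := y)
        cases r with
        | apex n =>
          have := H.lipschitz n x y
          simp only [coneDist]; split_ifs <;> first | omega | (subst_vars; linarith)
        | base n z =>
          have := dist_nonneg (x := y) (y := z)
          have := H.dist_le_one x z
          have := dist_triangle x y z
          simp only [coneDist]; split_ifs <;> first | omega | linarith
  eq_of_dist_eq_zero {p q} hpq := by
    change coneDist p q = 0 at hpq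
    cases p <;> cases q <;> simp only [coneDist] at hpq <;> split_ifs at hpq with hmn <;>
      simp_all <;> linarith [H.one_le _ _ |>.trans_eq hpq]

theorem dist_apex_apex_of_ne (H : IsHeight h) {m n : ℕ} (hmn : m ≠ n) :
    letI := metricSpace H
    dist (apex m : ConeSum h) (apex n) = 2 := if_neg hmn

theorem dist_apex_base (H : IsHeight h) (n : ℕ) (x : E) :
    letI := metricSpace H
    dist (apex n : ConeSum h) (base n x) = h n x := if_pos rfl

theorem dist_base_base (H : IsHeight h) (n : ℕ) (x y : E) :
    letI := metricSpace H
    dist (base n x : ConeSum h) (base n y) = dist x y := if_pos rfl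

theorem isometry_base (H : IsHeight h) (n : ℕ) :
    letI := metricSpace H
    Isometry (base n : E → ConeSum h) :=
  letI := metricSpace H
  Isometry.of_dist_eq fun x y => dist_base_base H n x y

theorem apex_eq_of_dist_lt_one (H : IsHeight h) {n : ℕ} {p : ConeSum h}
    (hp : coneDist (apex n) p < 1) : p = apex n := by
  cases p with
  | apex m => simp only [coneDist] at hp; split_ifs at hp <;> simp_all
  | base m x =>
    have := H.one_le m x
    simp only [coneDist] at hp; split_ifs at hp <;> linarith

theorem exists_base_of_dist_lt_one (H : IsHeight h) {n : ℕ} {x : E} {p : ConeSum h}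
    (hp : coneDist (base n x) p < 1) : ∃ y, p = base n y := by
  cases p with
  | apex m =>
    have := H.one_le m x
    simp only [coneDist] at hp; split_ifs at hp <;> linarith
  | base m y =>
    simp only [coneDist] at hp; split_ifs at hp with hnm
    · subst hnm; exact ⟨y, rfl⟩
    · linarith

theorem completeSpace [CompleteSpace E] (H : IsHeight h) :
    letI := metricSpace H
    CompleteSpace (ConeSum h) := by
  let := metricSpace H
  refine Metric.complete_of_cauchySeq_tendsto fun u hu => ?_
  -- Within distance less than 1 of `u N`, the sequence stays at one apex or in one base.
  obtain ⟨N, hN⟩ := Metric.cauchySeq_iff'.1 hu 1 one_pos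
  have hN' : ∀ k, coneDist (u N) (u (k + N)) < 1 := fun k => by
    have := hN (k + N) (Nat.le_add_left _ _)
    rw [dist_comm] at this
    exact this
  have hshift : CauchySeq fun k => u (k + N) :=
    hu.comp_tendsto (tendsto_add_atTop_nat N)
  suffices ∃ a, Tendsto (fun k => u (k + N)) atTop (𝓝 a) from
    this.imp fun a ha => (tendsto_add_atTop_iff_nat N).1 ha
  cases hp : u N with
  | apex n =>
    simp only [hp] at hN'
    refine ⟨apex n, tendsto_const_nhds.congr fun k => (apex_eq_of_dist_lt_one H (hN' k)).symm⟩
  | base n x =>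
    simp only [hp] at hN'
    choose v hv using fun k => exists_base_of_dist_lt_one H (hN' k)
    have hvu : (fun k => u (k + N)) = base n ∘ v := funext hv
    rw [hvu] at hshift ⊢
    rw [CauchySeq, ← map_map, (isometry_base H n).isUniformInducing.cauchy_map_iff] at hshift
    obtain ⟨a, ha⟩ := cauchySeq_tendsto_of_complete (u := v) hshift
    exact ⟨base n a, ((isometry_base H n).continuous.tendsto a).comp ha⟩

/-- Every apex realizes the distances 0 and 2, and these cannot be confused with heights, which lie
in `[1, 2)`. -/
theorem scottEquivOne_apex_iff (H : IsHeight h) (m n : ℕ) :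
    letI := metricSpace H
    ScottEquivOne (fun _ : Fin 1 => (apex m : ConeSum h)) (fun _ : Fin 1 => apex n) ↔
      (∀ x, ∃ z, h m x = h n z) ∧ ∀ z, ∃ x, h m x = h n z := by
  let := metricSpace H
  rw [scottEquivOne_singleton_iff]
  have hb : ∀ (k l : ℕ) (x : E) (p : ConeSum h),
      dist (apex k : ConeSum h) (base k x) = dist (apex l) p → ∃ z, h k x = h l z := by
    intro k l x p hp
    rw [dist_apex_base H] at hp
    have h1 := H.one_le k x
    have h2 := H.lt_two k x
    cases p with
    | apex i =>
      change _ = ite _ _ _ at hp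
      split_ifs at hp <;> linarith
    | base i z =>
      change _ = ite _ _ _ at hp
      split_ifs at hp with hli
      · subst hli; exact ⟨z, hp⟩
      · linarith
  have hall : ∀ k l : ℕ, (∀ x, ∃ z, h k x = h l z) →
      ∀ p : ConeSum h, ∃ q : ConeSum h, dist (apex k : ConeSum h) p = dist (apex l) q := by
    intro k l hkl p
    have two : ∃ q : ConeSum h, 2 = dist (apex l) q :=
      ⟨apex (l + 1), (dist_apex_apex_of_ne H (by omega)).symm⟩
    cases p with
    | apex i =>
      by_cases hi : k = i
      · subst hi; exact ⟨apex l, by simp⟩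
      · rwa [dist_apex_apex_of_ne H hi]
    | base i x =>
      by_cases hi : k = i
      · subst hi
        obtain ⟨z, hz⟩ := hkl x
        exact ⟨base l z, by rw [dist_apex_base H, dist_apex_base H, hz]⟩
      · have : dist (apex k : ConeSum h) (base i x) = 2 := if_neg hi
        rwa [this]
  constructor
  · rintro ⟨h1, h2⟩
    refine ⟨fun x => ?_, fun z => ?_⟩
    · obtain ⟨p, hp⟩ := h1 (base m x)
      exact hb _ _ _ _ hp
    · obtain ⟨p, hp⟩ := h2 (base n z)
      obtain ⟨x, hx⟩ := hb _ _ _ _ hp.symm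
      exact ⟨x, hx.symm⟩
  · rintro ⟨h1, h2⟩
    refine ⟨hall m n h1, fun q => ?_⟩
    obtain ⟨p, hp⟩ := hall n m (fun z => (h2 z).imp fun x hx => hx.symm) q
    exact ⟨p, hp.symm⟩

end ConeSum

end ScottPolish
-- Bit sequences: graphs truncated at expulsion
namespace ScottPolish

open Nat.Partrec (Code)
open Encodable (encode)

/-- The initial segment of `x` of length `k`. -/
def prefixOf (x : ℕ → ℕ) (k : ℕ) : List ℕ := (List.range k).map x

@[simp] theorem length_prefixOf (x : ℕ → ℕ) (k : ℕ) : (prefixOf x k).length = k := by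
  simp [prefixOf]

theorem take_prefixOf (x : ℕ → ℕ) (i k : ℕ) :
    (prefixOf x k).take i = prefixOf x (min i k) := by
  simp [prefixOf, ← List.map_take, List.take_range]

theorem map_prefixOf (g : ℕ → ℕ) (x : ℕ → ℕ) (k : ℕ) :
    (prefixOf x k).map g = prefixOf (fun i => g (x i)) k := by
  simp [prefixOf, Function.comp_def]

theorem tail_prefixOf (x : ℕ → ℕ) (k : ℕ) :
    (prefixOf x k).tail = prefixOf (fun i => x (i + 1)) (k - 1) := by
  cases k <;> simp [prefixOf, List.range_succ_eq_map, Function.comp_def]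

theorem prefixOf_congr {x y : ℕ → ℕ} {k : ℕ} (hxy : ∀ i < k, x i = y i) :
    prefixOf x k = prefixOf y k :=
  List.map_congr_left fun i hi => hxy i (List.mem_range.1 hi)

theorem getElem?_prefixOf (x : ℕ → ℕ) {i k : ℕ} (hi : i < k) : (prefixOf x k)[i]? = some (x i) := by
  simp [prefixOf, hi]

theorem headI_prefixOf (x : ℕ → ℕ) {k : ℕ} (hk : 0 < k) : (prefixOf x k).headI = x 0 := by
  cases k with
  | zero => omega
  | succ k => simp [prefixOf, List.range_succ_eq_map]

theorem isInitialSegment_iff (s : List ℕ) (x : ℕ → ℕ) :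
    IsInitialSegment s x ↔ prefixOf x s.length = s := Iff.rfl

/-- `LiveAt e l` says that, by stage `l.length`, no point with initial segment `l` has been expelled
from the set with index `e`. If the flag, the second component of the first entry, is `0`, a point
is expelled when the program coded by `e` is seen to halt on one of its initial segments;
otherwise it is expelled at the stage given by the flag. -/
def LiveAt (e : ℕ) (l : List ℕ) : Prop :=
  (l.headI.unpair.2 = 0 ∧ ∀ j < l.length + 1,
    Code.evaln l.length (Denumerable.ofNat Code e.unpair.1)
      (Nat.pair e.unpair.2 (encode (l.take j))) = none) ∨ l.length < l.headI.unpair.2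

theorem primrecPred_liveAt : PrimrecPred fun p : ℕ × List ℕ => LiveAt p.1 p.2 := by
  have hflag : Primrec fun p : ℕ × List ℕ => p.2.headI.unpair.2 :=
    Primrec.snd.comp (Primrec.unpair.comp (Primrec.list_headI.comp Primrec.snd))
  have hlen : Primrec fun p : ℕ × List ℕ => p.2.length := Primrec.list_length.comp Primrec.snd
  have hrel : PrimrecRel fun (j : ℕ) (p : ℕ × List ℕ) =>
      Code.evaln p.2.length (Denumerable.ofNat Code p.1.unpair.1)
        (Nat.pair p.1.unpair.2 (encode (p.2.take j))) = none := by
    have hu : Primrec fun q : ℕ × ℕ × List ℕ => q.2.1.unpair :=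
      Primrec.unpair.comp (Primrec.fst.comp Primrec.snd)
    refine Primrec.eq.comp (Code.primrec_evaln.comp (Primrec.pair (Primrec.pair
      (hlen.comp Primrec.snd) ((Primrec.ofNat Code).comp (Primrec.fst.comp hu)))
      (Primrec₂.natPair.comp (Primrec.snd.comp hu) (Primrec.encode.comp
        (Primrec.list_take.comp Primrec.fst (Primrec.snd.comp Primrec.snd))))))
      (Primrec.const none)
  have hall := (hrel.forall_mem_list.comp (Primrec.list_range.comp (Primrec.succ.comp hlen))
    Primrec.id).of_eq fun p => by simp only [List.mem_range, id, Nat.succ_eq_add_one]; rfl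
  exact ((Primrec.eq.comp hflag (Primrec.const 0)).and hall).or (Primrec.nat_lt.comp hlen hflag)

/-- Membership of the `(l.length - 1)`-th pair in the graph of the function given by the first
components of the entries of `l`, as long as `LiveAt e l` holds. -/
noncomputable def graphBit (e : ℕ) (l : List ℕ) : Bool :=
  open Classical in
  decide (LiveAt e l ∧ (l[(l.length - 1).unpair.1]?).map (fun v => v.unpair.1) =
    some (l.length - 1).unpair.2)

theorem primrec_graphBit : Primrec fun p : ℕ × List ℕ => graphBit p.1 p.2 := by
  classical
  have hlen : Primrec fun p : ℕ × List ℕ => (p.2.length - 1).unpair :=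
    Primrec.unpair.comp (Primrec.nat_sub.comp (Primrec.list_length.comp Primrec.snd)
      (Primrec.const 1))
  have h2 : PrimrecPred fun p : ℕ × List ℕ =>
      (p.2[(p.2.length - 1).unpair.1]?).map (fun v => v.unpair.1) =
        some (p.2.length - 1).unpair.2 :=
    Primrec.eq.comp (Primrec.option_map
      (Primrec.list_getElem?.comp Primrec.snd (Primrec.fst.comp hlen))
      (Primrec.fst.comp (Primrec.unpair.comp Primrec.snd)).to₂)
      (Primrec.option_some.comp (Primrec.snd.comp hlen))
  obtain ⟨_, h⟩ := primrecPred_liveAt.and h2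
  exact h.of_eq fun p => by simp only [graphBit, decide_eq_decide]

/-- The sequence of bits produced by the point `x` under the index `e`. -/
noncomputable def bits (e : ℕ) (x : ℕ → ℕ) (k : ℕ) : Bool := graphBit e (prefixOf x k)

theorem bits_congr (e : ℕ) {x y : ℕ → ℕ} {k : ℕ} (hxy : ∀ i < k, x i = y i) :
    bits e x k = bits e y k := by
  rw [bits, bits, prefixOf_congr hxy]

theorem bits_zero (e : ℕ) (x : ℕ → ℕ) : bits e x 0 = false := by
  simp [bits, graphBit, prefixOf]

/-- The shift by one makes the entry at `k.unpair.1 ≤ k` available in the prefix of length `k + 1`.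
-/
theorem bits_succ (e : ℕ) (x : ℕ → ℕ) (k : ℕ) :
    bits e x (k + 1) = true ↔
      LiveAt e (prefixOf x (k + 1)) ∧ (x k.unpair.1).unpair.1 = k.unpair.2 := by
  have : k.unpair.1 < k + 1 := (Nat.unpair_left_le k).trans_lt k.lt_succ_self
  simp [bits, graphBit, getElem?_prefixOf x this]

/-- The points with flag `0` that are never expelled from the set with index `e`. -/
def Survives (e : ℕ) (x : ℕ → ℕ) : Prop :=
  ∀ j, ¬(Code.eval (Denumerable.ofNat Code e.unpair.1)
    (Nat.pair e.unpair.2 (encode (prefixOf x j)))).Dom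

theorem liveAt_of_flag_ne_zero (e : ℕ) {x : ℕ → ℕ} (hx : (x 0).unpair.2 ≠ 0) (k : ℕ) :
    LiveAt e (prefixOf x (k + 1)) ↔ k + 1 < (x 0).unpair.2 := by
  simp [LiveAt, headI_prefixOf, hx]

theorem liveAt_of_flag_eq_zero (e : ℕ) {x : ℕ → ℕ} (hx : (x 0).unpair.2 = 0) (k : ℕ) :
    LiveAt e (prefixOf x (k + 1)) ↔ ∀ j ≤ k + 1,
      Code.evaln (k + 1) (Denumerable.ofNat Code e.unpair.1)
        (Nat.pair e.unpair.2 (encode (prefixOf x j))) = none := by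
  simp only [LiveAt, length_prefixOf, headI_prefixOf x k.succ_pos, hx, true_and, Nat.not_lt_zero,
    or_false, take_prefixOf, Nat.lt_succ_iff]
  exact forall₂_congr fun j hj => by rw [min_eq_left hj]

/-- A later stage has more fuel and tests more initial segments, so a halting computation once seen
stays seen. -/
theorem liveAt_anti (e : ℕ) (x : ℕ → ℕ) {k k' : ℕ} (hk : k ≤ k')
    (h : LiveAt e (prefixOf x (k' + 1))) : LiveAt e (prefixOf x (k + 1)) := by
  by_cases hx : (x 0).unpair.2 = 0
  · rw [liveAt_of_flag_eq_zero e hx] at h ⊢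
    intro j hj
    rw [Option.eq_none_iff_forall_not_mem]
    intro v hv
    have := Code.evaln_mono (Nat.succ_le_succ hk) hv
    simp [h j (by omega)] at this
  · rw [liveAt_of_flag_ne_zero e hx] at h ⊢
    omega

theorem forall_liveAt_iff (e : ℕ) (x : ℕ → ℕ) :
    (∀ k, LiveAt e (prefixOf x (k + 1))) ↔ (x 0).unpair.2 = 0 ∧ Survives e x := by
  by_cases hx : (x 0).unpair.2 = 0
  · simp only [liveAt_of_flag_eq_zero e hx, hx, true_and, Survives]
    constructor
    · intro h j hj
      obtain ⟨k, hk⟩ := Code.evaln_complete.1 (Part.get_mem hj)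
      -- The stage must provide the fuel `k` and also contain the initial segment of length `j`.
      have := Code.evaln_mono (show k ≤ max k j + 1 by omega) hk
      simp [h (max k j) j (by omega)] at this
    · intro h k j _
      rw [Option.eq_none_iff_forall_not_mem]
      intro v hv
      exact h j (Part.dom_iff_mem.2 ⟨v, Code.evaln_sound hv⟩)
  · simp only [liveAt_of_flag_ne_zero e hx, hx, false_and, iff_false, not_forall]
    exact ⟨(x 0).unpair.2, by omega⟩

/-- For every point `x` that is expelled under `e` there is a stage before which it is live. -/
theorem exists_forall_liveAt_iff_lt (e : ℕ) (x : ℕ → ℕ)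
    (h : ¬∀ k, LiveAt e (prefixOf x (k + 1))) :
    ∃ N, ∀ k, LiveAt e (prefixOf x (k + 1)) ↔ k < N := by
  classical
  push Not at h
  refine ⟨Nat.find h, fun k => ⟨fun hk => ?_, fun hk => not_not.1 (Nat.find_min h hk)⟩⟩
  by_contra hN
  exact Nat.find_spec h (liveAt_anti e x (not_lt.1 hN) hk)

/-- An index under which all points survive. -/
theorem exists_forall_survives : ∃ e, ∀ x, Survives e x := by
  obtain ⟨c, hc⟩ := Code.exists_code.1 Nat.Partrec.none
  refine ⟨Nat.pair (encode c) 0, fun x j => ?_⟩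
  simp [hc]

/-- Two indices produce the same sequences of bits. -/
def SameBits (m n : ℕ) : Prop :=
  (∀ x, ∃ z, bits m x = bits n z) ∧ ∀ z, ∃ x, bits m x = bits n z

theorem bits_eq_of_forall {m n : ℕ} {x z : ℕ → ℕ}
    (h : ∀ k, LiveAt m (prefixOf x (k + 1)) ↔ LiveAt n (prefixOf z (k + 1)))
    (hxz : ∀ i, (x i).unpair.1 = (z i).unpair.1) : bits m x = bits n z := by
  funext k
  cases k with
  | zero => rw [bits_zero, bits_zero]
  | succ k => rw [Bool.eq_iff_iff, bits_succ, bits_succ, h, hxz]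

/-- A full graph has a true bit at position `Nat.pair i (x i).unpair.1 + 1` for every `i`; there `z`
must be live and have the same value at `i`. These positions are unbounded. -/
theorem eq_of_bits_eq {m n : ℕ} {x z : ℕ → ℕ} (h : bits m x = bits n z)
    (hx : ∀ k, LiveAt m (prefixOf x (k + 1))) :
    (∀ k, LiveAt n (prefixOf z (k + 1))) ∧ ∀ i, (z i).unpair.1 = (x i).unpair.1 := by
  have key : ∀ i, LiveAt n (prefixOf z (Nat.pair i (x i).unpair.1 + 1)) ∧
      (z i).unpair.1 = (x i).unpair.1 := by
    intro i
    have h1 := (bits_succ m x (Nat.pair i (x i).unpair.1)).2 ⟨hx _, by simp⟩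
    rw [h, bits_succ] at h1
    simpa using h1
  exact ⟨fun k => liveAt_anti n z (Nat.left_le_pair _ _) (key k).1, fun i => (key i).2⟩

/-- Truncated graphs occur under both indices, and all full graphs occur under `e₀`, so only the
full graphs under `e` matter. -/
theorem sameBits_iff {e₀ : ℕ} (h₀ : ∀ x, Survives e₀ x) (e : ℕ) :
    SameBits e₀ e ↔
      ∀ f : ℕ → ℕ, ∃ z : ℕ → ℕ, (∀ i, (z i).unpair.1 = f i) ∧ (z 0).unpair.2 = 0 ∧
        Survives e z := by
  constructor
  · rintro ⟨h, -⟩ f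
    obtain ⟨z, hz⟩ := h fun i => Nat.pair (f i) 0
    have hlive := (forall_liveAt_iff e₀ fun i => Nat.pair (f i) 0).2 ⟨by simp, h₀ _⟩
    obtain ⟨h1, h2⟩ := eq_of_bits_eq hz hlive
    exact ⟨z, by simpa using h2, (forall_liveAt_iff e z).1 h1⟩
  · intro h
    refine ⟨fun x => ?_, fun z => ?_⟩
    · by_cases hx : (x 0).unpair.2 = 0
      · obtain ⟨z, hz1, hz2⟩ := h fun i => (x i).unpair.1
        exact ⟨z, bits_eq_of_forall (fun k => iff_of_true
          ((forall_liveAt_iff e₀ x).2 ⟨hx, h₀ x⟩ k) ((forall_liveAt_iff e z).2 hz2 k))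
          fun i => (hz1 i).symm⟩
      -- With a nonzero flag the bits do not depend on the index.
      · exact ⟨x, bits_eq_of_forall (fun k => by
          rw [liveAt_of_flag_ne_zero _ hx, liveAt_of_flag_ne_zero _ hx]) fun i => rfl⟩
    · by_cases hz : ∀ k, LiveAt e (prefixOf z (k + 1))
      · exact ⟨z, bits_eq_of_forall (fun k => iff_of_true
          ((forall_liveAt_iff e₀ z).2 ⟨((forall_liveAt_iff e z).1 hz).1, h₀ z⟩ k) (hz k))
          fun i => rfl⟩
      · obtain ⟨N, hN⟩ := exists_forall_liveAt_iff_lt e z hz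
        -- The flag `N + 1` is nonzero even for `N = 0` and expels at exactly the stage at which `z`
        -- is expelled under `e`.
        refine ⟨fun i => Nat.pair (z i).unpair.1 (N + 1), bits_eq_of_forall (fun k => ?_)
          fun i => by simp⟩
        rw [liveAt_of_flag_ne_zero _ (by simp), hN]
        simp

end ScottPolish
-- Heights as base 4 expansions
namespace ScottPolish

open Cardinal (cantorFunction)

/-- The natural number with base `4` digits `b 0, …, b (k - 1)`. -/
noncomputable def digitValue (b : ℕ → Bool) (k : ℕ) : ℕ :=
  Nat.rec 0 (fun j v => 4 * v + (b j).toNat) k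

theorem digitValue_succ (b : ℕ → Bool) (k : ℕ) :
    digitValue b (k + 1) = 4 * digitValue b k + (b k).toNat := rfl

theorem digitValue_congr {b b' : ℕ → Bool} {k : ℕ} (h : ∀ i < k, b i = b' i) :
    digitValue b k = digitValue b' k := by
  induction k with
  | zero => rfl
  | succ k ih =>
    rw [digitValue_succ, digitValue_succ, ih fun i hi => h i (hi.trans k.lt_succ_self),
      h k k.lt_succ_self]

theorem cantorFunction_quarter_eq (b : ℕ → Bool) (k : ℕ) :
    cantorFunction (1 / 4) b =
      (4 * digitValue b k + cantorFunction (1 / 4) fun i => b (i + k)) / 4 ^ k := by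
  induction k with
  | zero => simp [digitValue]
  | succ k ih =>
    rw [ih, Cardinal.cantorFunction_succ (fun i => b (i + k)) (by norm_num) (by norm_num),
      digitValue_succ]
    have : (fun n => b (n + 1 + k)) = fun i => b (i + (k + 1)) :=
      funext fun n => by rw [add_right_comm, add_assoc]
    rw [this, Nat.zero_add]
    cases b k <;> simp <;> field_simp <;> ring

theorem cantorFunction_quarter_nonneg (b : ℕ → Bool) : 0 ≤ cantorFunction (1 / 4) b :=
  tsum_nonneg fun _ => Cardinal.cantorFunctionAux_nonneg (by norm_num)

theorem cantorFunction_quarter_le (b : ℕ → Bool) : cantorFunction (1 / 4) b ≤ 4 / 3 := by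
  refine (Cardinal.cantorFunction_le (g := fun _ => true) (by norm_num) (by norm_num)
    fun _ _ => rfl).trans_eq ?_
  simp only [cantorFunction, Cardinal.cantorFunctionAux_true]
  rw [tsum_geometric_of_lt_one (by norm_num) (by norm_num)]
  norm_num

/-- The distance of the point `x` from the apex with index `n`. -/
noncomputable def height (n : ℕ) (x : ℕ → ℕ) : ℝ := 1 + cantorFunction (1 / 4) (bits n x) / 4

/-- The ratio `1 / 4` is below `1 / 2`, so the expansion determines its digits. -/
theorem height_eq_iff (m n : ℕ) (x z : ℕ → ℕ) : height m x = height n z ↔ bits m x = bits n z := by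
  constructor
  · intro h
    refine Cardinal.cantorFunction_injective (c := 1 / 4) (by norm_num) (by norm_num) ?_
    simp only [height] at h
    linarith
  · intro h
    rw [height, height, h]

/-- The approximation of `height n x` with `k` bits after the point. -/
noncomputable def heightApprox (n : ℕ) (x : ℕ → ℕ) (k : ℕ) : ℕ :=
  2 ^ k + digitValue (bits n x) k / 2 ^ k

theorem abs_height_sub_le (n : ℕ) (x : ℕ → ℕ) (k : ℕ) :
    |height n x - (heightApprox n x k : ℝ) / 2 ^ k| ≤ 1 / 2 ^ k := by
  have h0 := cantorFunction_quarter_nonneg fun i => bits n x (i + k)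
  have h1 := cantorFunction_quarter_le fun i => bits n x (i + k)
  rw [height, cantorFunction_quarter_eq _ k, heightApprox]
  generalize cantorFunction (1 / 4) (fun i => bits n x (i + k)) = t at h0 h1
  have hp : (1 : ℕ) ≤ 2 ^ k := Nat.one_le_two_pow
  have hlt := Nat.mod_lt (digitValue (bits n x) k) (show 2 ^ k > 0 by omega)
  have hdm := Nat.div_add_mod (digitValue (bits n x) k) (2 ^ k)
  generalize digitValue (bits n x) k / 2 ^ k = q at hdm
  generalize digitValue (bits n x) k % 2 ^ k = r at hdm hlt
  rw [← hdm]
  have h4 : (4 : ℝ) ^ k = 2 ^ k * 2 ^ k := by rw [← mul_pow]; norm_num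
  have hr : (r : ℝ) + 1 ≤ 2 ^ k := by exact_mod_cast hlt
  have hr0 : (0 : ℝ) ≤ r := r.cast_nonneg
  push_cast
  rw [h4]
  have hP : (0 : ℝ) < 2 ^ k := by positivity
  generalize (2 : ℝ) ^ k = P at hr hP
  -- With `P = 2 ^ k`, the error consists of the remainder `r ≤ P - 1` and the tail `t / 4 ≤ 1 / 3`,
  -- over `P * P`.
  have e : 1 + (4 * (P * q + r) + t) / (P * P) / 4 - (P + q) / P = (r + t / 4) / (P * P) := by
    field_simp
    ring
  rw [e, abs_of_nonneg (by positivity), div_le_div_iff₀ (by positivity) hP]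
  nlinarith

-- The computable Polish space of cones

attribute [local instance] PiNat.metricSpaceNatNat

theorem dist_nat_eq_of_ne {x y : ℕ → ℕ} (h : x ≠ y) :
    dist x y = (1 / 2) ^ PiNat.firstDiff x y := PiNat.dist_eq_of_ne h

theorem isHeight_height : IsHeight height where
  dist_le_one x y := PiNat.dist_le_one x y
  one_le n x := by
    have := cantorFunction_quarter_nonneg (bits n x)
    rw [height]
    linarith
  lt_two n x := by
    have := cantorFunction_quarter_le (bits n x)
    rw [height]
    linarith
  -- Bit `i` reads only entries below `i`, so points that agree below `k` share their first `k`
  -- digits. The tails change the height by at most `(4 / 3) / (4 * 4 ^ k)`, below the distance `2 ^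
  -- (-k)`.
  lipschitz n x y := by
    by_cases hxy : x = y
    · simp [hxy]
    rw [dist_nat_eq_of_ne hxy, height, height]
    set k := PiNat.firstDiff x y with hk
    rw [cantorFunction_quarter_eq (bits n x) k, cantorFunction_quarter_eq (bits n y) k,
      digitValue_congr (b := bits n x) (b' := bits n y) fun i hi => bits_congr n fun j hj =>
        PiNat.apply_eq_of_lt_firstDiff (hj.trans hi)]
    have h0 := cantorFunction_quarter_nonneg fun i => bits n y (i + k)
    have h1 := cantorFunction_quarter_le fun i => bits n x (i + k)
    have h2 : ((1 : ℝ) / 2) ^ k = 2 ^ k / 4 ^ k := by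
      rw [← div_pow]; norm_num
    have h3 : (1 : ℝ) ≤ 2 ^ k := one_le_pow₀ (by norm_num)
    rw [h2, div_div, div_div, add_assoc, add_le_add_iff_left,
      show (2 : ℝ) ^ k / 4 ^ k = 4 * 2 ^ k / (4 ^ k * 4) by field_simp, ← add_div]
    exact div_le_div_of_nonneg_right (by linarith) (by positivity)

/-- The maximum of `1` and `2 ^ k` times the distance of `x` and `y`. -/
def distApprox (x y : ℕ → ℕ) (k : ℕ) : ℕ :=
  Nat.rec 1 (fun j v => if v = 1 ∧ x j = y j then 1 else 2 * v) k

theorem distApprox_succ (x y : ℕ → ℕ) (k : ℕ) : distApprox x y (k + 1) =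
    if distApprox x y k = 1 ∧ x k = y k then 1 else 2 * distApprox x y k := rfl

theorem distApprox_eq_one (x y : ℕ → ℕ) (k : ℕ) (h : ∀ i < k, x i = y i) :
    distApprox x y k = 1 := by
  induction k with
  | zero => rfl
  | succ k ih =>
    rw [distApprox_succ, if_pos ⟨ih fun i hi => h i (hi.trans k.lt_succ_self), h k k.lt_succ_self⟩]

theorem distApprox_of_ne {x y : ℕ → ℕ} (hxy : x ≠ y) (j : ℕ) :
    distApprox x y (PiNat.firstDiff x y + (j + 1)) = 2 ^ (j + 1) := by
  induction j with
  | zero =>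
    rw [zero_add, distApprox_succ, distApprox_eq_one _ _ _ fun i => PiNat.apply_eq_of_lt_firstDiff,
      if_neg fun h => PiNat.apply_firstDiff_ne hxy h.2]
    rfl
  | succ j ih =>
    rw [← add_assoc, distApprox_succ, ih, if_neg fun h => by
      have := h.1
      rw [pow_succ] at this
      omega]
    ring

theorem abs_dist_sub_le (x y : ℕ → ℕ) (k : ℕ) :
    |dist x y - (distApprox x y k : ℝ) / 2 ^ k| ≤ 1 / 2 ^ k := by
  by_cases hxy : x = y
  · subst hxy
    rw [distApprox_eq_one _ _ _ fun _ _ => rfl, dist_self, zero_sub, abs_neg, Nat.cast_one,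
      abs_of_nonneg (by positivity)]
  rw [dist_nat_eq_of_ne hxy]
  rcases le_or_gt k (PiNat.firstDiff x y) with hk | hk
  · rw [distApprox_eq_one _ _ _ fun i hi => PiNat.apply_eq_of_lt_firstDiff (hi.trans_le hk)]
    have : ((1 : ℝ) / 2) ^ PiNat.firstDiff x y ≤ (1 / 2) ^ k :=
      pow_le_pow_of_le_one (by norm_num) (by norm_num) hk
    rw [one_div_pow (2 : ℝ) k] at this
    have h0 : (0 : ℝ) ≤ (1 / 2) ^ PiNat.firstDiff x y := by positivity
    rw [Nat.cast_one, abs_le]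
    have h1 : (0 : ℝ) ≤ 1 / 2 ^ k := by positivity
    constructor <;> linarith
  · obtain ⟨j, rfl⟩ := Nat.exists_eq_add_of_lt hk
    rw [add_assoc, distApprox_of_ne hxy, show ((1 : ℝ) / 2) ^ PiNat.firstDiff x y =
      ((2 ^ (j + 1) : ℕ) : ℝ) / 2 ^ (PiNat.firstDiff x y + (j + 1)) by
        rw [pow_add, one_div_pow]; push_cast; field_simp; ring, sub_self, abs_zero]
    positivity

/-- The sequence that begins with the entries of `l` and continues with zeros. -/
def padZero (l : List ℕ) (i : ℕ) : ℕ := l.getD i 0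

theorem padZero_prefixOf (x : ℕ → ℕ) {i k : ℕ} (h : i < k) : padZero (prefixOf x k) i = x i := by
  simp [padZero, getElem?_prefixOf x h]

theorem denseRange_padZero : DenseRange padZero := by
  refine Metric.denseRange_iff.2 fun x r hr => ?_
  obtain ⟨k, hk⟩ := exists_pow_lt_of_lt_one hr (show (1 / 2 : ℝ) < 1 by norm_num)
  exact ⟨prefixOf x k, (PiNat.mem_cylinder_iff_dist_le.1 (PiNat.mem_cylinder_iff.2 fun i hi =>
    (padZero_prefixOf x hi).symm)).trans_lt hk⟩

theorem primrec_padZero : Primrec₂ padZero := Primrec.list_getD 0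

theorem primrec_two_pow : Primrec fun k : ℕ => 2 ^ k :=
  (Primrec.nat_rec₁ 1 (Primrec.nat_mul.comp Primrec.snd (Primrec.const 2)).to₂).of_eq fun k => by
    induction k with
    | zero => rfl
    | succ k ih => rw [pow_succ, ← ih]

theorem primrec_distApprox :
    Primrec fun p : (List ℕ × List ℕ) × ℕ => distApprox (padZero p.1.1) (padZero p.1.2) p.2 := by
  refine Primrec.nat_rec' Primrec.snd (Primrec.const 1) (Primrec.ite
    (PrimrecPred.and (Primrec.eq.comp (Primrec.snd.comp Primrec.snd) (Primrec.const 1))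
      (Primrec.eq.comp
        (primrec_padZero.comp (Primrec.fst.comp (Primrec.fst.comp Primrec.fst))
          (Primrec.fst.comp Primrec.snd))
        (primrec_padZero.comp (Primrec.snd.comp (Primrec.fst.comp Primrec.fst))
          (Primrec.fst.comp Primrec.snd))))
    (Primrec.const 1) (Primrec.nat_mul.comp (Primrec.const 2) (Primrec.snd.comp Primrec.snd))).to₂

theorem primrec_bits :
    Primrec fun p : (ℕ × List ℕ) × ℕ => bits p.1.1 (padZero p.1.2) p.2 :=
  primrec_graphBit.comp (Primrec.pair (Primrec.fst.comp Primrec.fst)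
    (Primrec.list_map (Primrec.list_range.comp Primrec.snd)
      (primrec_padZero.comp (Primrec.snd.comp (Primrec.fst.comp Primrec.fst)) Primrec.snd).to₂))

theorem primrec_heightApprox :
    Primrec fun p : (ℕ × List ℕ) × ℕ => heightApprox p.1.1 (padZero p.1.2) p.2 := by
  have hpow := primrec_two_pow.comp (Primrec.snd (α := ℕ × List ℕ) (β := ℕ))
  refine Primrec.nat_add.comp hpow (Primrec.nat_div.comp ?_ hpow)
  refine Primrec.nat_rec' Primrec.snd (Primrec.const 0) (Primrec.nat_add.comp
    (Primrec.nat_mul.comp (Primrec.const 4) (Primrec.snd.comp Primrec.snd))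
    ((Primrec.dom_finite Bool.toNat).comp
      (primrec_bits.comp (Primrec.pair (Primrec.fst.comp Primrec.fst)
        (Primrec.fst.comp Primrec.snd))))).to₂

/-- The disjoint union of cones with the given heights. -/
abbrev Cones : Type := ConeSum height

noncomputable instance metricSpaceCones : MetricSpace Cones := ConeSum.metricSpace isHeight_height

/-- Codes of special points: `none` codes an apex, a finite sequence the point of the base obtained
by padding it with zeros. -/
def specialPoint (p : ℕ × Option (List ℕ)) : Cones :=
  p.2.elim (.apex p.1) fun l => .base p.1 (padZero l)

theorem denseRange_specialPoint : DenseRange specialPoint := by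
  refine Metric.denseRange_iff.2 fun q r hr => ?_
  cases q with
  | apex n => exact ⟨(n, none), by simpa [specialPoint] using hr⟩
  | base n x =>
    obtain ⟨l, hl⟩ := Metric.denseRange_iff.1 denseRange_padZero x r hr
    exact ⟨(n, some l), (ConeSum.dist_base_base isHeight_height n x _).trans_lt hl⟩

/-- The approximations of the distances of special points. -/
noncomputable def pointDistApprox (q : ((ℕ × Option (List ℕ)) × (ℕ × Option (List ℕ))) × ℕ) : ℕ :=
  if q.1.1.1 = q.1.2.1 then
    Option.casesOn q.1.1.2
      (Option.casesOn q.1.2.2 0 fun l => heightApprox q.1.1.1 (padZero l) q.2)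
      fun l => Option.casesOn q.1.2.2 (heightApprox q.1.1.1 (padZero l) q.2)
        fun l' => distApprox (padZero l) (padZero l') q.2
  else 2 * 2 ^ q.2

theorem primrec_pointDistApprox : Primrec pointDistApprox := by
  have h1 : Primrec fun q : ((ℕ × Option (List ℕ)) × (ℕ × Option (List ℕ))) × ℕ => q.1.1 :=
    Primrec.fst.comp Primrec.fst
  have h2 : Primrec fun q : ((ℕ × Option (List ℕ)) × (ℕ × Option (List ℕ))) × ℕ => q.1.2 :=
    Primrec.snd.comp Primrec.fst
  have hA : Primrec₂ fun (q : ((ℕ × Option (List ℕ)) × (ℕ × Option (List ℕ))) × ℕ) (l : List ℕ) =>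
      heightApprox q.1.1.1 (padZero l) q.2 :=
    (primrec_heightApprox.comp (Primrec.pair (Primrec.pair
      (Primrec.fst.comp (h1.comp Primrec.fst)) Primrec.snd) (Primrec.snd.comp Primrec.fst))).to₂
  have hD : Primrec₂ fun (r : (((ℕ × Option (List ℕ)) × (ℕ × Option (List ℕ))) × ℕ) × List ℕ)
      (l' : List ℕ) => distApprox (padZero r.2) (padZero l') r.1.2 :=
    (primrec_distApprox.comp (Primrec.pair
      (Primrec.pair (Primrec.snd.comp Primrec.fst) Primrec.snd)
      (Primrec.snd.comp (Primrec.fst.comp Primrec.fst)))).to₂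
  have hnone := Primrec.option_casesOn (Primrec.snd.comp h2) (Primrec.const 0) hA
  have hsome := Primrec.option_casesOn (Primrec.snd.comp (h2.comp Primrec.fst)) hA hD
  have hcases := Primrec.option_casesOn (Primrec.snd.comp h1) hnone hsome.to₂
  exact Primrec.ite (Primrec.eq.comp (Primrec.fst.comp h1) (Primrec.fst.comp h2)) hcases
    (Primrec.nat_mul.comp (Primrec.const 2) (primrec_two_pow.comp Primrec.snd))

theorem abs_dist_specialPoint_sub_le (p q : ℕ × Option (List ℕ)) (k : ℕ) :
    |dist (specialPoint p) (specialPoint q) - (pointDistApprox ((p, q), k) : ℝ) / 2 ^ k|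
      ≤ 1 / 2 ^ k := by
  obtain ⟨m, a⟩ := p
  obtain ⟨n, b⟩ := q
  by_cases hmn : m = n
  · subst hmn
    cases a with
    | none =>
      cases b with
      | none => simp [specialPoint, pointDistApprox]
      | some l =>
        have : dist (specialPoint (m, none)) (specialPoint (m, some l)) = height m (padZero l) :=
          ConeSum.dist_apex_base isHeight_height m _
        simpa [this, pointDistApprox] using abs_height_sub_le m (padZero l) k
    | some l =>
      cases b with
      | none =>
        have : dist (specialPoint (m, some l)) (specialPoint (m, none)) = height m (padZero l) := by
          rw [dist_comm]
          exact ConeSum.dist_apex_base isHeight_height m _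
        simpa [this, pointDistApprox] using abs_height_sub_le m (padZero l) k
      | some l' =>
        have : dist (specialPoint (m, some l)) (specialPoint (m, some l')) =
            dist (padZero l) (padZero l') := ConeSum.dist_base_base isHeight_height m _ _
        simpa [this, pointDistApprox] using abs_dist_sub_le (padZero l) (padZero l') k
  · have : dist (specialPoint (m, a)) (specialPoint (n, b)) = 2 := by
      cases a <;> cases b <;> exact if_neg hmn
    simp [this, pointDistApprox, hmn]

/-- The computable structure on the disjoint union of cones. -/
noncomputable def computableStructureCones : ComputableStructure Cones where
  pt i := specialPoint (Denumerable.ofNat _ i)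
  dense_pt := by
    refine denseRange_specialPoint.mono ?_
    rintro _ ⟨p, rfl⟩
    exact ⟨Encodable.encode p, congrArg specialPoint (Denumerable.ofNat_encode p)⟩
  dist_computable := by
    refine ⟨fun q => pointDistApprox ((Denumerable.ofNat _ q.1, Denumerable.ofNat _ q.2.1), q.2.2),
      ?_, fun i j k => abs_dist_specialPoint_sub_le _ _ k⟩
    exact (primrec_pointDistApprox.comp (Primrec.pair (Primrec.pair
      ((Primrec.ofNat _).comp Primrec.fst)
      ((Primrec.ofNat _).comp (Primrec.fst.comp Primrec.snd)))
      (Primrec.snd.comp Primrec.snd))).to_comp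

theorem isComputableSeq_apex :
    computableStructureCones.IsComputableSeq (ConeSum.apex : ℕ → Cones) := by
  refine ⟨fun p => Encodable.encode (p.1, (none : Option (List ℕ))),
    (Primrec.encode.comp (Primrec.pair Primrec.fst (Primrec.const none))).to_comp, fun n k => ?_⟩
  have : computableStructureCones.pt (Encodable.encode (n, (none : Option (List ℕ)))) =
      ConeSum.apex n :=
    congrArg specialPoint (Denumerable.ofNat_encode (n, (none : Option (List ℕ))))
  rw [this, dist_self]
  positivity

theorem scottEquivOne_apex_iff_sameBits (m n : ℕ) :
    ScottEquivOne (fun _ : Fin 1 => (ConeSum.apex m : Cones)) (fun _ : Fin 1 => ConeSum.apex n) ↔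
      SameBits m n := by
  simp only [ConeSum.scottEquivOne_apex_iff isHeight_height, height_eq_iff, SameBits]

end ScottPolish
-- `Π¹₂`-completeness of `SameBits`
namespace ScottPolish

open Nat.Partrec (Code)
open Encodable (encode)

theorem rePred_comp {α β : Type} [Primcodable α] [Primcodable β] {p : β → Prop}
    (hp : REPred p) {f : α → β} (hf : Computable f) : REPred fun a => p (f a) :=
  Partrec.comp hp hf

/-- Programs enumerate the semirecursive predicates on a coded type. -/
theorem exists_code_of_rePred {α : Type} [Primcodable α] {p : α → Prop} (hp : REPred p) :
    ∃ c : Code, ∀ a, (c.eval (encode a)).Dom ↔ p a := by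
  obtain ⟨c, hc⟩ := Code.exists_code.1 hp
  refine ⟨c, fun a => ?_⟩
  simp [hc, Part.assert]

/-- The interleaving of `f` and `g`, with flag `0`. -/
def interleave (f g : ℕ → ℕ) (i : ℕ) : ℕ := Nat.pair (f i) (Nat.casesOn i 0 g)

/-- The finite sequences in the second and the first components of the entries of `l`, cut off
at the lengths coded by the length of `l`. -/
def splitList (l : List ℕ) : Fin 2 → List ℕ :=
  ![(l.tail.map fun v => v.unpair.2).take (l.length - 1).unpair.1,
    (l.map fun v => v.unpair.1).take (l.length - 1).unpair.2]

theorem primrec_splitList : Primrec splitList := by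
  have hlen : Primrec fun l : List ℕ => (l.length - 1).unpair :=
    Primrec.unpair.comp (Primrec.nat_sub.comp Primrec.list_length (Primrec.const 1))
  have h0 : Primrec fun l : List ℕ =>
      (l.tail.map fun v => v.unpair.2).take (l.length - 1).unpair.1 :=
    Primrec.list_take.comp (Primrec.fst.comp hlen) (Primrec.list_map Primrec.list_tail
      (Primrec.snd.comp (Primrec.unpair.comp Primrec.snd)).to₂)
  have h1 : Primrec fun l : List ℕ =>
      (l.map fun v => v.unpair.1).take (l.length - 1).unpair.2 :=
    Primrec.list_take.comp (Primrec.snd.comp hlen) (Primrec.list_map Primrec.id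
      (Primrec.fst.comp (Primrec.unpair.comp Primrec.snd)).to₂)
  have h : ∀ i : Fin 2, Primrec fun l => splitList l i := by
    rw [Fin.forall_fin_two]
    exact ⟨h0, h1⟩
  exact Primrec.fin_curry.2 (Primrec₂.swap (Primrec.fin_curry₁.2 h))

theorem splitList_prefixOf (x : ℕ → ℕ) (k : ℕ) :
    splitList (prefixOf x k) =
      ![prefixOf (fun i => (x (i + 1)).unpair.2) (min (k - 1).unpair.1 (k - 1)),
        prefixOf (fun i => (x i).unpair.1) (min (k - 1).unpair.2 k)] := by
  simp only [splitList, tail_prefixOf, map_prefixOf, take_prefixOf, length_prefixOf]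

/-- A test on pairs of initial segments of the witness and the function becomes a test on prefixes
of the single point `x`, since the length of a prefix codes the two lengths. -/
theorem exists_splitList_iff (P : (Fin 2 → List ℕ) → Prop) (x : ℕ → ℕ) :
    (∃ k, P (splitList (prefixOf x k))) ↔
      ∃ s, P s ∧ ∀ i, IsInitialSegment (s i)
        ((![fun i => (x (i + 1)).unpair.2, fun i => (x i).unpair.1] : Fin 2 → ℕ → ℕ) i) := by
  constructor
  · rintro ⟨k, hk⟩
    refine ⟨_, hk, ?_⟩
    rw [splitList_prefixOf, Fin.forall_fin_two]
    simp [isInitialSegment_iff]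
  · rintro ⟨s, hs, hseg⟩
    rw [Fin.forall_fin_two] at hseg
    simp only [isInitialSegment_iff, Matrix.cons_val_zero, Matrix.cons_val_one] at hseg
    -- The extra entry is the one that `List.tail` drops: the second component of entry 0 is the
    -- flag, so the witness starts at entry 1.
    refine ⟨Nat.pair (s 0).length (s 1).length + 1, ?_⟩
    rw [splitList_prefixOf, Nat.add_sub_cancel, Nat.unpair_pair,
      min_eq_left (Nat.left_le_pair _ _),
      min_eq_left ((Nat.right_le_pair _ _).trans (Nat.le_succ _)), hseg.1, hseg.2]
    convert hs using 1
    funext i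
    fin_cases i <;> rfl

/-- A `Π¹₂` set of numbers in terms of a semirecursive predicate. -/
theorem IsPi12Set.exists_rePred {B : Set ℕ} (hB : IsPi12Set B) :
    ∃ W : ℕ × (Fin 2 → List ℕ) → Prop, REPred W ∧ ∀ n, n ∈ B ↔ ∀ f : ℕ → ℕ, ∃ g : ℕ → ℕ,
      ¬∃ s, W (n, s) ∧ ∀ i, IsInitialSegment (s i) ((![g, f] : Fin 2 → ℕ → ℕ) i) := by
  obtain ⟨Q, ⟨R, ⟨W, hW, hRW⟩, hQR⟩, hBQ⟩ := hB
  refine ⟨W, hW, fun n => ?_⟩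
  have h1 := Set.ext_iff.1 hBQ (n, Fin.elim0)
  rw [← not_iff_not]
  refine h1.trans ?_
  simp only [not_forall, not_exists]
  refine exists_congr fun f => ?_
  have h2 := Set.ext_iff.1 hQR (n, (Fin.cons f Fin.elim0 : Fin 1 → ℕ → ℕ))
  have h3 : (∃ g : ℕ → ℕ, (n, (![g, f] : Fin 2 → ℕ → ℕ)) ∈ R) ↔
      (n, (Fin.cons f Fin.elim0 : Fin 1 → ℕ → ℕ)) ∈ Qᶜ := h2.symm
  have h4 : (n, (Fin.cons f Fin.elim0 : Fin 1 → ℕ → ℕ)) ∈ Q ↔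
      ¬∃ g : ℕ → ℕ, (n, (![g, f] : Fin 2 → ℕ → ℕ)) ∈ R := by
    rw [h3, Set.mem_compl_iff, not_not]
  refine h4.trans ?_
  rw [not_exists]
  refine forall_congr' fun g => ?_
  have h5 := hRW n ![g, f]
  rw [Set.mem_compl_iff] at h5
  rw [h5]
  simp only [not_not]

/-- The number `n` is sent to the index that pairs a fixed program, halting on the bad segments,
with the parameter `n`; the other index expels nothing. -/
theorem oneOneReducible_sameBits {B : Set ℕ} (hB : IsPi12Set B) :
    OneOneReducible (fun n => n ∈ B) (fun p : ℕ × ℕ => SameBits p.1 p.2) := by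
  obtain ⟨W, hW, hBW⟩ := hB.exists_rePred
  obtain ⟨c, hc⟩ := exists_code_of_rePred
    (rePred_comp hW (f := fun q : ℕ × List ℕ => (q.1, splitList q.2))
      (Primrec.pair Primrec.fst (primrec_splitList.comp Primrec.snd)).to_comp)
  obtain ⟨e₀, he₀⟩ := exists_forall_survives
  refine ⟨fun n => (e₀, Nat.pair (encode c) n), (Primrec.pair (Primrec.const _)
    (Primrec₂.natPair.comp (Primrec.const _) Primrec.id)).to_comp, fun m n h => ?_, fun n => ?_⟩
  · simpa using h
  have hsurv : ∀ x, Survives (Nat.pair (encode c) n) x ↔ ¬∃ s, W (n, s) ∧ ∀ i,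
      IsInitialSegment (s i)
        ((![fun i => (x (i + 1)).unpair.2, fun i => (x i).unpair.1] : Fin 2 → ℕ → ℕ) i) := by
    intro x
    rw [← exists_splitList_iff (fun s => W (n, s)), not_exists]
    refine forall_congr' fun j => ?_
    rw [Nat.unpair_pair, Denumerable.ofNat_encode]
    exact not_congr (hc (n, prefixOf x j))
  change n ∈ B ↔ SameBits e₀ (Nat.pair (encode c) n)
  rw [hBW, sameBits_iff he₀]
  refine forall_congr' fun f => ?_
  constructor
  · rintro ⟨g, hg⟩
    refine ⟨interleave f g, fun i => by simp [interleave], by simp [interleave], ?_⟩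
    rw [hsurv]
    simpa [interleave] using hg
  · rintro ⟨z, hz, -, hs⟩
    refine ⟨fun i => (z (i + 1)).unpair.2, ?_⟩
    rwa [hsurv, funext hz] at hs

/-- Finite sequences witnessing that `s 0` does not lead to a response to the challenge `s 1`. -/
def Separates (q : (ℕ × ℕ) × (Fin 2 → List ℕ)) : Prop :=
  (q.2 0).length = (q.2 1).length ∧
    ¬(graphBit q.1.1 (q.2 1) = graphBit q.1.2 ((q.2 0).map fun v => v.unpair.1) ∧
      graphBit q.1.2 (q.2 1) = graphBit q.1.1 ((q.2 0).map fun v => v.unpair.2))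

theorem rePred_separates : REPred Separates := by
  have h0 : Primrec fun q : (ℕ × ℕ) × (Fin 2 → List ℕ) => q.2 0 :=
    Primrec.fin_app.comp Primrec.snd (Primrec.const 0)
  have h1 : Primrec fun q : (ℕ × ℕ) × (Fin 2 → List ℕ) => q.2 1 :=
    Primrec.fin_app.comp Primrec.snd (Primrec.const 1)
  have hm : Primrec fun q : (ℕ × ℕ) × (Fin 2 → List ℕ) => q.1.1 := Primrec.fst.comp Primrec.fst
  have hn : Primrec fun q : (ℕ × ℕ) × (Fin 2 → List ℕ) => q.1.2 := Primrec.snd.comp Primrec.fst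
  have hf := Primrec.list_map h0 (Primrec.fst.comp (Primrec.unpair.comp Primrec.snd)).to₂
  have hs := Primrec.list_map h0 (Primrec.snd.comp (Primrec.unpair.comp Primrec.snd)).to₂
  have hbit : ∀ {e : (ℕ × ℕ) × (Fin 2 → List ℕ) → ℕ} {l : (ℕ × ℕ) × (Fin 2 → List ℕ) → List ℕ},
      Primrec e → Primrec l → Primrec fun q => graphBit (e q) (l q) :=
    fun he hl => primrec_graphBit.comp (Primrec.pair he hl)
  have hpred : PrimrecPred Separates :=
    (Primrec.eq.comp (Primrec.list_length.comp h0) (Primrec.list_length.comp h1)).and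
      ((Primrec.eq.comp (hbit hm h1) (hbit hn hf)).and
        (Primrec.eq.comp (hbit hn h1) (hbit hm hs))).not
  obtain ⟨hd, hp⟩ := hpred
  exact ComputablePred.to_re ⟨hd, hp.to_comp⟩

/-- One `x` serves as a challenge on both sides, and `w` codes the pair of responses, which leaves a
single `∀ ∃` over sequences. -/
theorem sameBits_iff_forall_exists (m n : ℕ) :
    SameBits m n ↔ ∀ x, ∃ w : ℕ → ℕ, bits m x = bits n (fun i => (w i).unpair.1) ∧
      bits n x = bits m (fun i => (w i).unpair.2) := by
  constructor
  · rintro ⟨h1, h2⟩ x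
    obtain ⟨z, hz⟩ := h1 x
    obtain ⟨y, hy⟩ := h2 x
    exact ⟨fun i => Nat.pair (z i) (y i), by simpa using hz, by simpa using hy.symm⟩
  · intro h
    refine ⟨fun x => ?_, fun z => ?_⟩
    · obtain ⟨w, hw, -⟩ := h x
      exact ⟨_, hw⟩
    · obtain ⟨w, -, hw⟩ := h z
      exact ⟨_, hw.symm⟩

/-- A disagreement at bit `k` is visible in the prefixes of length `k`, so equality of bits is
effectively closed. -/
theorem exists_separates_iff (m n : ℕ) (v : Fin 2 → ℕ → ℕ) :
    (∃ s : Fin 2 → List ℕ, Separates ((m, n), s) ∧ ∀ i, IsInitialSegment (s i) (v i)) ↔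
      ¬(bits m (v 1) = bits n (fun i => (v 0 i).unpair.1) ∧
        bits n (v 1) = bits m (fun i => (v 0 i).unpair.2)) := by
  constructor
  · rintro ⟨s, ⟨hlen, hne⟩, hseg⟩ ⟨h1, h2⟩
    simp only [isInitialSegment_iff] at hseg
    simp only at hlen hne
    refine hne ?_
    rw [← hseg 0, ← hseg 1, hlen, map_prefixOf, map_prefixOf]
    exact ⟨congrFun h1 _, congrFun h2 _⟩
  · intro h
    obtain ⟨k, hk⟩ : ∃ k, ¬(bits m (v 1) k = bits n (fun i => (v 0 i).unpair.1) k ∧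
        bits n (v 1) k = bits m (fun i => (v 0 i).unpair.2) k) := by
      by_contra! hall
      exact h ⟨funext fun k => (hall k).1, funext fun k => (hall k).2⟩
    refine ⟨fun i => prefixOf (v i) k, ⟨by simp, ?_⟩, fun i => by simp [isInitialSegment_iff]⟩
    simpa only [map_prefixOf, bits] using hk

theorem isPi12Set_sameBits : IsPi12Set {p : ℕ × ℕ | SameBits p.1 p.2} := by
  let R : Set ((ℕ × ℕ) × (Fin 2 → ℕ → ℕ)) :=
    {q | bits q.1.1 (q.2 1) = bits q.1.2 (fun i => (q.2 0 i).unpair.1) ∧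
      bits q.1.2 (q.2 1) = bits q.1.1 (fun i => (q.2 0 i).unpair.2)}
  have hR : IsPi01 R :=
    ⟨Separates, rePred_separates, fun p v => (exists_separates_iff p.1 p.2 v).symm⟩
  refine ⟨(projBaire R)ᶜ, ⟨R, hR, compl_compl _⟩, ?_⟩
  ext ⟨⟨m, n⟩, v⟩
  change ¬SameBits m n ↔ ∃ x, ¬∃ w : ℕ → ℕ, _ ∧ _
  rw [sameBits_iff_forall_exists, not_forall]
  rfl

end ScottPolish

theorem mainTheorem6 :
    ∃ (X : Type) (_ : MetricSpace X) (_ : CompleteSpace X)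
      (S : ScottPolish.ComputableStructure X) (y : ℕ → X),
      S.IsComputableSeq y ∧ Function.Injective y ∧
        ScottPolish.IsPi12Complete
          {p : ℕ × ℕ | ScottPolish.ScottEquivOne (fun _ : Fin 1 => y p.1) (fun _ : Fin 1 => y p.2)} := by
  let := PiNat.metricSpaceNatNat
  refine ⟨ScottPolish.Cones, ScottPolish.metricSpaceCones,
    ScottPolish.ConeSum.completeSpace ScottPolish.isHeight_height,
    ScottPolish.computableStructureCones, ScottPolish.ConeSum.apex,
    ScottPolish.isComputableSeq_apex, fun m n h => ScottPolish.ConeSum.apex.inj h, ?_⟩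
  simp only [ScottPolish.scottEquivOne_apex_iff_sameBits]
  exact ⟨ScottPolish.isPi12Set_sameBits, fun B hB => ScottPolish.oneOneReducible_sameBits hB⟩
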